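/- Let $\mathbb{D}=\{z\in\mathbb{C}:|z|<1\}$ and let $\mathcal{A}$ be the class of analytic functions $f$ on $\mathbb{D}$ with $f(0)=0$, $f'(0)=1$. For functions $p,\varphi$ on $\mathbb{D}$ write $p\prec\varphi$ if $p=\varphi\circ w$ for some analytic $w:\mathbb{D}\to\mathbb{D}$ with $w(0)=0$. For $\varphi$ with $\varphi(0)=1$ let $\mathcal{S}^{*}(\varphi)$ be the class of all $f\in\mathcal{A}$ such that $zf'(z)/f(z)\prec\varphi(z)$ (in particular $f$ has no zeros in $\mathbb{D}\setminus\{0\}$, and the quotient has the value $1$ at $z=0$). Let $\mathcal{F}_{\mathcal{LP}}=\mathcal{S}^{*}(\mathcal{LP})$ with $$\mathcal{LP}(z)=1-\frac{2}{\pi^{2}}\left(\log\frac{1+\sqrt z}{1-\sqrt z}\right)^{2}.$$ For a class $\mathcal{G}\subset\mathcal{A}$, the sharp $\mathcal{F}_{\mathcal{LP}}$-radius $\mathcal{R}(\mathcal{G})$ is the largest $R\in(0,1]$ such that for every $f\in\mathcal{G}$ and every $0<r\le R$ the function $z\mapsto f(rz)/r$ belongs to $\mathcal{F}_{\mathcal{LP}}$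 (that is, $f$ belongs to $\mathcal{F}_{\mathcal{LP}}$ in $|z|<r$). Consider the following classes $\mathcal{S}^*(\varphi)$ (all roots, logarithms and $\sinh^{-1}$ being principal branches): - $\mathcal{S}^{*}_{p}$: $\varphi(z)=1+\frac{2}{\pi^{2}}\left(\log\frac{1+\sqrt z}{1-\sqrt z}\right)^{2}$; - $\mathcal{S}^{*}_{s}$: $\varphi(z)=1+\sin z$; - $\Delta^{*}$: $\varphi(z)=z+\sqrt{1+z^{2}}$; - $\mathcal{S}^{*}_{\varrho}$: $\varphi(z)=\cosh\sqrt z$; - $\mathcal{S}^{*}_{\rho}$: $\varphi(z)=1+\sinh^{-1}z$; - $\mathcal{S}^{*}_{\wp}$: $\varphi(z)=1+ze^{z}$; - $\mathcal{BS}^{*}(\alpha)$: $\varphi(z)=1+\frac{z}{1-\alpha z^{2}}$; - $\mathcal{S}^{*}_{\alpha,e}$: $\varphi(z)=\alpha+(1-\alpha)e^{z}$, with $\mathcal{S}^{*}_{e}=\mathcal{S}^{*}_{0,e}$; - $\mathcal{S}^{*}(A,B)$: $\varphi(z)=\frac{1+Az}{1+Bz}$. **Theorem.** Let $0\le\alpha<1$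 and $-1<B<A\le1$. Then each of the following radii exists (as a largest value), and 1. $\mathcal{R}(\mathcal{S}^{*}_{p})=\tanh^{2}(\pi/4)$. 2. $\mathcal{R}(\mathcal{S}^{*}_{s})=\pi/6$. 3. $\mathcal{R}(\Delta^{*})=5/12$. 4. $\mathcal{R}(\mathcal{S}^{*}_{\varrho})=(\cosh^{-1}(3/2))^{2}$. 5. $\mathcal{R}(\mathcal{S}^{*}_{\rho})=\sinh(1/2)$. 6. $\mathcal{R}(\mathcal{S}^{*}_{\wp})=R$, where $R$ is the real solution of $Re^{R}=1/2$; $R=0.3517\ldots$ 7. $\mathcal{R}(\mathcal{BS}^{*}(\alpha))=1/2$ if $\alpha=0$, and $=(\sqrt{1+\alpha}-1)/\alpha$ if $0<\alpha<1$. 8. $\mathcal{R}(\mathcal{S}^{*}_{\alpha,e})=\log\left(1-\frac{1}{2(\alpha-1)}\right)$ if $0\le\alpha<1-\frac{1}{2(e-1)}$, and $=1$ if $1-\frac{1}{2(e-1)}\le\alpha<1$. In particular $\mathcal{R}(\mathcal{S}^{*}_{e})=\log(3/2)$. 9. $\mathcal{R}(\mathcal{S}^{*}(A,B))=\frac{1}{2A-3B}$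 if either $A<0$ and $B\le\frac{2A-1}{3}$, or $A\ge0$ and $B<\frac{2A-1}{3}$; and $\mathcal{R}(\mathcal{S}^{*}(A,B))=1$ if either $A<0$ and $B>\frac{2A-1}{3}$, or $A\ge0$ and $B\ge\frac{2A-1}{3}$. -/

import Mathlib

noncomputable section

namespace ParabolicRadius

/-- The open unit disc. -/
def unitDisc : Set ℂ := Metric.ball 0 1

/-- The class `𝒜`: functions analytic on the unit disc with `f(0) = 0` and `f'(0) = 1`. Functions
are total on `ℂ`; their values outside the disc play no role. -/
def classA : Set (ℂ → ℂ) :=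
  {f | DifferentiableOn ℂ f unitDisc ∧ f 0 = 0 ∧ deriv f 0 = 1}

/-- Subordination `p ≺ φ` on the unit disc: `p = φ ∘ w` for a Schwarz function `w`. -/
def Subordinate (p φ : ℂ → ℂ) : Prop :=
  ∃ w : ℂ → ℂ, DifferentiableOn ℂ w unitDisc ∧ Set.MapsTo w unitDisc unitDisc ∧ w 0 = 0 ∧
    ∀ z ∈ unitDisc, p z = φ (w z)

/-- The quotient `z f'(z) / f(z)`, with its removable singularity at `0` filled by the limit `1`
(for `f ∈ 𝒜`). -/
def logQuot (f : ℂ → ℂ) (z : ℂ) : ℂ :=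
  if z = 0 then 1 else z * deriv f z / f z

/-- `f` has no zero in the punctured disc, that is, `z f'(z) / f(z)` has no pole. -/
def NoZeros (f : ℂ → ℂ) : Prop :=
  ∀ z ∈ unitDisc, z ≠ 0 → f z ≠ 0

/-- The class of `f ∈ 𝒜` with `z f'(z) / f(z) ≺ φ(z)`; it is written `𝒮*(φ)` for Ma-Minda `φ`. -/
def starClass (φ : ℂ → ℂ) : Set (ℂ → ℂ) :=
  {f | f ∈ classA ∧ NoZeros f ∧ Subordinate (logQuot f) φ}

/-- The class `ℱ(ψ)` of `f ∈ 𝒜` with `z f'(z) / f(z) - 1 ≺ ψ(z)`. -/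
def classF (ψ : ℂ → ℂ) : Set (ℂ → ℂ) :=
  {f | f ∈ classA ∧ NoZeros f ∧ Subordinate (fun z => logQuot f z - 1) ψ}

/-- `(log ((1 + √z) / (1 - √z)))²`. The principal square root is used; by `logSq_eq` the value does
not depend on the branch. -/
def logSq (z : ℂ) : ℂ :=
  (Complex.log ((1 + Complex.sqrt z) / (1 - Complex.sqrt z))) ^ 2

/-- Either square root of `z` gives the same value of `logSq z` for `z` in the unit disc. -/
theorem logSq_eq {z s : ℂ} (hz : z ∈ unitDisc) (hs : s ^ 2 = z) :
    logSq z = (Complex.log ((1 + s) / (1 - s))) ^ 2 := by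
  have hq : Complex.sqrt z ^ 2 = z := by
    simp [Complex.sqrt, ← Complex.cpow_nat_mul]
  have hn : ‖s‖ < 1 := by
    have h1 : ‖z‖ < 1 := by simpa [unitDisc] using hz
    rw [← hs, norm_pow] at h1
    by_contra h
    nlinarith [norm_nonneg s]
  rcases sq_eq_sq_iff_eq_or_eq_neg.mp (hq.trans hs.symm) with h | h
  · simp [logSq, h]
  · have hre : |s.re| < 1 := lt_of_le_of_lt (Complex.abs_re_le_norm s) hn
    have h1 : (1 : ℂ) - s ≠ 0 := by
      intro h0
      have := congrArg Complex.re h0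
      simp at this
      have := abs_lt.mp hre
      linarith
    have harg : Complex.arg ((1 + s) / (1 - s)) ≠ Real.pi := by
      intro hpi
      have hlt := (Complex.arg_eq_pi_iff.mp hpi).1
      have hpos : 0 ≤ ((1 + s) / (1 - s)).re := by
        rw [Complex.div_re, ← add_div]
        apply div_nonneg _ (Complex.normSq_nonneg _)
        have h2 : s.re ^ 2 + s.im ^ 2 < 1 := by
          have := Complex.sq_norm s
          rw [Complex.normSq_apply] at this
          nlinarith [norm_nonneg s]
        simp
        nlinarith
      linarith
    have hinv : (1 + -s) / (1 - -s) = ((1 + s) / (1 - s))⁻¹ := by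
      rw [inv_div]; ring
    rw [logSq, h, hinv, Complex.log_inv _ harg, neg_sq]

/-- `ℒ𝒫(z) = 1 - (2/π²) (log ((1 + √z) / (1 - √z)))²`. -/
def LP (z : ℂ) : ℂ := 1 - 2 / (Real.pi : ℂ) ^ 2 * logSq z

/-- The class `ℱ_ℒ𝒫`: `f ∈ 𝒜` with `z f'(z) / f(z) ≺ ℒ𝒫(z)`. -/
def FLP : Set (ℂ → ℂ) := starClass LP

/-- The class `𝒮*_p`. -/
def Sp : Set (ℂ → ℂ) := starClass fun z => 1 + 2 / (Real.pi : ℂ) ^ 2 * logSq z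

/-- The class `𝒮*_s`. -/
def Ss : Set (ℂ → ℂ) := starClass fun z => 1 + Complex.sin z

/-- The class `Δ*`. -/
def DeltaStar : Set (ℂ → ℂ) := starClass fun z => z + Complex.sqrt (1 + z ^ 2)

/-- The class `𝒮*_ϱ`, given by `cosh √z`. -/
def Svarrho : Set (ℂ → ℂ) := starClass fun z => Complex.cosh (Complex.sqrt z)

/-- The principal branch of `sinh⁻¹` (holomorphic on the unit disc). -/
def arsinhC (z : ℂ) : ℂ := Complex.log (z + Complex.sqrt (1 + z ^ 2))

/-- The class `𝒮*_ρ`, given by `1 + sinh⁻¹ z`. -/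
def Srho : Set (ℂ → ℂ) := starClass fun z => 1 + arsinhC z

/-- The class `𝒮*_℘`. -/
def Swp : Set (ℂ → ℂ) := starClass fun z => 1 + z * Complex.exp z

/-- The class `ℬ𝒮*(α)`: `z f'(z) / f(z) - 1 ≺ z / (1 - α z²)` (Booth lemniscate). -/
def BS (α : ℝ) : Set (ℂ → ℂ) := classF fun z => z / (1 - (α : ℂ) * z ^ 2)

/-- The class `𝒮*_{α,e}`. -/
def Sexp (α : ℝ) : Set (ℂ → ℂ) :=
  starClass fun z => (α : ℂ) + (1 - (α : ℂ)) * Complex.exp z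

/-- The class `𝒮*_e`. -/
def Se : Set (ℂ → ℂ) := starClass Complex.exp

/-- The Janowski class `𝒮*(A, B)`. -/
def Janowski (A B : ℝ) : Set (ℂ → ℂ) :=
  starClass fun z => (1 + (A : ℂ) * z) / (1 + (B : ℂ) * z)

/-- The dilation `z ↦ f(r z) / r`; "`f` belongs to a class in `|z| < r`" means that this function
belongs to the class. -/
def dilate (r : ℝ) (f : ℂ → ℂ) (z : ℂ) : ℂ := f ((r : ℂ) * z) / (r : ℂ)

/-- `R` is the sharp `F`-radius of the class `G`: the largest `R ∈ (0, 1]` such that every `f ∈ G`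
belongs to `F` in `|z| < r` for every `0 < r ≤ R`. -/
def IsSharpRadius (F G : Set (ℂ → ℂ)) (R : ℝ) : Prop :=
  IsGreatest {R' : ℝ | 0 < R' ∧ R' ≤ 1 ∧ ∀ r : ℝ, 0 < r → r ≤ R' → ∀ f ∈ G, dilate r f ∈ F} R

end ParabolicRadius

end

namespace ParabolicRadius

open Complex Set Filter Topology

/-! `LP` maps the unit disc conformally onto the parabolic region `2u + v² < 3`, with explicit
inverse `LPInv`. Hence a holomorphic `p` with `p 0 = 1` is subordinate to `LP` exactly when its
values lie in that region (`subordinate_LP`, `Subordinate.mapsTo_parabolaRegion`).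

If the quotient of `f` is `φ ∘ w`, Schwarz's lemma gives `|w(z)| ≤ |z|`, so it suffices that `φ`
maps `|z| < R` into the region. Conversely, some `f` has quotient exactly `φ`, and `φ(R) = 3/2`, the
vertex, rules out any larger radius. This is `isSharpRadius_starClass`; what remains is one
inclusion per class.

For most classes `φ` sends `|z| < R` into the disc `|w - 1| < 1/2`, which lies in the region; often
this follows by comparing `|φ(z) - 1|` with `φ(|z|) - 1`. For Janowski functions the image is
another disc, internally tangent at the vertex when `R < 1`. For `1 + sin z` and `1 + sinh⁻¹ z` the
image leaves `|w - 1| < 1/2`, and the parabola itself has to be used. -/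

/-- The open parabolic region with focus `1` and vertex `3 / 2`, opening to the left. -/
def parabolaRegion : Set ℂ := {w | 2 * w.re + w.im ^ 2 < 3}

theorem mem_parabolaRegion {w : ℂ} : w ∈ parabolaRegion ↔ 2 * w.re + w.im ^ 2 < 3 := Iff.rfl

/-! ### Square roots and logarithms on the disc -/

theorem mem_unitDisc {z : ℂ} : z ∈ unitDisc ↔ ‖z‖ < 1 := by simp [unitDisc]

theorem isOpen_unitDisc : IsOpen unitDisc := Metric.isOpen_ball

theorem zero_mem_unitDisc : (0 : ℂ) ∈ unitDisc := by simp [mem_unitDisc]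

theorem sqrt_sq (z : ℂ) : Complex.sqrt z ^ 2 = z := by
  simp [Complex.sqrt, ← Complex.cpow_nat_mul]

theorem norm_sqrt_sq (z : ℂ) : ‖Complex.sqrt z‖ ^ 2 = ‖z‖ := by
  rw [← norm_pow, sqrt_sq]

theorem norm_sqrt_lt_one {z : ℂ} (hz : ‖z‖ < 1) : ‖Complex.sqrt z‖ < 1 := by
  have := norm_sqrt_sq z
  nlinarith [norm_nonneg (Complex.sqrt z)]

theorem sq_norm_eq (z : ℂ) : ‖z‖ ^ 2 = z.re ^ 2 + z.im ^ 2 := by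
  rw [Complex.sq_norm, Complex.normSq_apply]; ring

theorem one_sub_ne_zero_of_norm_lt_one {s : ℂ} (hs : ‖s‖ < 1) : 1 - s ≠ 0 := by
  intro h
  rw [← sub_eq_zero.mp h] at hs
  simp at hs

theorem re_one_add_div_one_sub_pos {s : ℂ} (hs : ‖s‖ < 1) : 0 < ((1 + s) / (1 - s)).re := by
  have h0 := one_sub_ne_zero_of_norm_lt_one hs
  rw [Complex.div_re, ← add_div]
  refine div_pos ?_ (Complex.normSq_pos.mpr h0)
  have := sq_norm_eq s
  simp
  nlinarith [norm_nonneg s]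

theorem log_one_add_div_one_sub {s : ℂ} (hs : ‖s‖ < 1) :
    log ((1 + s) / (1 - s)) = log (1 + s) - log (1 - s) := by
  have hre := abs_lt.mp (lt_of_le_of_lt (abs_re_le_norm s) hs)
  have h1 : 0 < (1 + s).re := by simp; linarith
  have h2 : 0 < (1 - s).re := by simp; linarith
  have a1 := abs_lt.mp (abs_arg_lt_pi_div_two_iff.mpr (Or.inl h1))
  have a2 := abs_lt.mp (abs_arg_lt_pi_div_two_iff.mpr (Or.inl h2))
  have n1 : 1 + s ≠ 0 := fun h => by simp [h] at h1
  have n2 : 1 - s ≠ 0 := fun h => by simp [h] at h2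
  rw [← log_exp (x := log (1 + s) - log (1 - s)), exp_sub, exp_log n1, exp_log n2]
  · simp [log_im]; linarith
  · simp [log_im]; linarith

/-- An even function of a square root is differentiable as a function of the square. -/
theorem DifferentiableOn.comp_sqrt_of_even {g : ℂ → ℂ} {U : Set ℂ} (hU : IsOpen U)
    (hg : ∀ s, s ^ 2 ∈ U → DifferentiableAt ℂ g s) (heven : ∀ s, s ^ 2 ∈ U → g (-s) = g s) :
    DifferentiableOn ℂ (fun z => g (Complex.sqrt z)) U := by
  have key : ∀ z ∈ U, z ≠ 0 → DifferentiableAt ℂ (fun z => g (Complex.sqrt z)) z := by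
    intro z hz hz0
    by_cases hs : z ∈ slitPlane
    · exact DifferentiableAt.fun_comp' z (hg _ (by rwa [sqrt_sq])) (differentiableAt_sqrt hs)
    · have hneg : -z ∈ slitPlane := by
        rw [mem_slitPlane_iff] at hs ⊢
        push Not at hs
        left
        have : z.re ≠ 0 := fun h => hz0 (Complex.ext h hs.2)
        simpa using lt_of_le_of_ne hs.1 this
      -- On the branch cut, `I * sqrt (-y)` is a holomorphic root. It agrees with the principal root
      -- up to sign, which the even `g` ignores. The origin is then a removable singularity.
      have hsq : ∀ y, (I * Complex.sqrt (-y)) ^ 2 = y := fun y => by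
        rw [mul_pow, sqrt_sq, I_sq]; ring
      have heq : (fun z => g (Complex.sqrt z)) =ᶠ[𝓝 z]
          fun y => g (I * Complex.sqrt (-y)) := by
        filter_upwards [hU.mem_nhds hz] with y hy
        rcases sq_eq_sq_iff_eq_or_eq_neg.mp ((sqrt_sq y).trans (hsq y).symm) with h | h
        · rw [h]
        · rw [h, heven _ (by rwa [hsq])]
      refine DifferentiableAt.congr_of_eventuallyEq ?_ heq
      refine DifferentiableAt.fun_comp' z (hg _ (by rwa [hsq])) ?_
      exact (DifferentiableAt.fun_comp' z (differentiableAt_sqrt hneg)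
        differentiableAt_id.neg).const_mul I
  intro z hz
  refine DifferentiableAt.differentiableWithinAt ?_
  rcases eq_or_ne z 0 with rfl | hz0
  · refine (analyticAt_of_differentiable_on_punctured_nhds_of_continuousAt ?_ ?_).differentiableAt
    · filter_upwards [self_mem_nhdsWithin, nhdsWithin_le_nhds (hU.mem_nhds hz)] with y hy hyU
      exact key y hyU hy
    · exact ContinuousAt.comp' (f := Complex.sqrt) (g := g)
        (hg _ (by rwa [sqrt_sq])).continuousAt (continuousAt_sqrt (by simp))
  · exact key z hz hz0

theorem differentiableOn_logSq : DifferentiableOn ℂ logSq unitDisc := by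
  have hn : ∀ s : ℂ, s ^ 2 ∈ unitDisc → ‖s‖ < 1 := fun s hs => by
    rw [mem_unitDisc, norm_pow] at hs
    by_contra h
    nlinarith
  refine DifferentiableOn.comp_sqrt_of_even (g := fun s => log ((1 + s) / (1 - s)) ^ 2)
    isOpen_unitDisc (fun s hs => ?_) (fun s hs => ?_)
  · have h1 := one_sub_ne_zero_of_norm_lt_one (hn s hs)
    have h2 : (1 + s) / (1 - s) ∈ slitPlane := Or.inl (re_one_add_div_one_sub_pos (hn s hs))
    fun_prop (disch := assumption)
  · rw [← logSq_eq hs rfl, ← logSq_eq hs (neg_sq s)]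

theorem differentiable_cosh_sqrt : Differentiable ℂ fun z => cosh (Complex.sqrt z) :=
  differentiableOn_univ.mp <| DifferentiableOn.comp_sqrt_of_even isOpen_univ
    (fun _ _ => differentiable_cosh.differentiableAt) fun s _ => cosh_neg s

/-! ### The conformal map onto the parabolic region -/

/-- With `ζ = ξ + iη`, the defect `3 - 2u - v²` factors as `(π² + 4ξ²)(π² - 4η²) / π⁴`, so only the
width of the strip matters. -/
theorem one_sub_sq_mem_parabolaRegion_iff {ζ : ℂ} :
    1 - 2 / (Real.pi : ℂ) ^ 2 * ζ ^ 2 ∈ parabolaRegion ↔ |ζ.im| < Real.pi / 2 := by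
  have hpi := Real.pi_pos
  have h1 : 1 - 2 / (Real.pi : ℂ) ^ 2 * ζ ^ 2 =
      1 - ((2 / Real.pi ^ 2 : ℝ) : ℂ) * (ζ * ζ) := by push_cast; ring
  rw [h1, mem_parabolaRegion]
  simp only [sub_re, sub_im, one_re, one_im, mul_re, mul_im, ofReal_re, ofReal_im, zero_mul,
    sub_zero, add_zero]
  have h3 : 3 - (2 * (1 - 2 / Real.pi ^ 2 * (ζ.re * ζ.re - ζ.im * ζ.im)) +
      (0 - 2 / Real.pi ^ 2 * (ζ.re * ζ.im + ζ.im * ζ.re)) ^ 2) =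
      (Real.pi ^ 2 + 4 * ζ.re ^ 2) * (Real.pi ^ 2 - 4 * ζ.im ^ 2) / Real.pi ^ 4 := by
    field_simp; ring
  have h4 : |ζ.im| < Real.pi / 2 ↔ ζ.im ^ 2 < (Real.pi / 2) ^ 2 := by
    rw [← sq_lt_sq₀ (abs_nonneg _) (half_pos hpi).le, sq_abs]
  rw [h4, ← sub_pos, h3, div_pos_iff_of_pos_right (by positivity), mul_pos_iff_of_pos_left
    (by positivity)]
  constructor <;> intro h <;> linarith

theorem LP_mem_parabolaRegion {z : ℂ} (hz : z ∈ unitDisc) : LP z ∈ parabolaRegion := by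
  have hpos := re_one_add_div_one_sub_pos (norm_sqrt_lt_one (mem_unitDisc.mp hz))
  exact one_sub_sq_mem_parabolaRegion_iff.mpr
    (by rw [log_im]; exact abs_arg_lt_pi_div_two_iff.mpr (Or.inl hpos))

/-- The inverse of the conformal map `LP` of the unit disc onto the parabolic region. -/
noncomputable def LPInv (p : ℂ) : ℂ :=
  (cosh (Complex.sqrt ((Real.pi : ℂ) ^ 2 / 2 * (1 - p))) - 1) /
    (cosh (Complex.sqrt ((Real.pi : ℂ) ^ 2 / 2 * (1 - p))) + 1)

theorem abs_im_lt_of_mem_parabolaRegion {p ζ : ℂ} (hp : p ∈ parabolaRegion)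
    (hζ : ζ ^ 2 = (Real.pi : ℂ) ^ 2 / 2 * (1 - p)) : |ζ.im| < Real.pi / 2 := by
  have hpi : (Real.pi : ℂ) ≠ 0 := by exact_mod_cast Real.pi_ne_zero
  rw [← one_sub_sq_mem_parabolaRegion_iff, hζ]
  convert hp using 1
  field_simp
  ring

theorem re_exp_pos {ζ : ℂ} (h : |ζ.im| < Real.pi / 2) : 0 < (exp ζ).re := by
  rw [exp_re]
  exact mul_pos (Real.exp_pos _) (Real.cos_pos_of_mem_Ioo (abs_lt.mp h))

/-- Both sides are `tanh² (ζ / 2)`. The `cosh` form is even in `ζ`, hence holomorphic in `ζ²`; the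
`exp` form exhibits a square root `s` with `(1 + s) / (1 - s) = exp ζ`. -/
theorem cosh_sub_one_div_cosh_add_one (ζ : ℂ) (h : exp ζ + 1 ≠ 0) :
    cosh ζ + 1 ≠ 0 ∧
      (cosh ζ - 1) / (cosh ζ + 1) = ((exp ζ - 1) / (exp ζ + 1)) ^ 2 := by
  have h0 := exp_ne_zero ζ
  have h1 : cosh ζ + 1 = (exp ζ + 1) ^ 2 / (2 * exp ζ) := by
    rw [cosh, exp_neg]; field_simp; ring
  have h2 : cosh ζ - 1 = (exp ζ - 1) ^ 2 / (2 * exp ζ) := by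
    rw [cosh, exp_neg]; field_simp; ring
  refine ⟨by rw [h1]; exact div_ne_zero (pow_ne_zero 2 h) (mul_ne_zero two_ne_zero h0), ?_⟩
  rw [h1, h2, div_pow]
  field_simp

theorem cosh_sqrt_add_one_ne_zero {p : ℂ} (hp : p ∈ parabolaRegion) :
    cosh (Complex.sqrt ((Real.pi : ℂ) ^ 2 / 2 * (1 - p))) + 1 ≠ 0 := by
  refine (cosh_sub_one_div_cosh_add_one _ fun h => ?_).1
  have := re_exp_pos (abs_im_lt_of_mem_parabolaRegion hp (sqrt_sq _))
  have h' := congrArg re h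
  simp only [add_re, one_re, zero_re] at h'
  linarith

theorem differentiableOn_LPInv : DifferentiableOn ℂ LPInv parabolaRegion := by
  have h : Differentiable ℂ fun p : ℂ => cosh (Complex.sqrt ((Real.pi : ℂ) ^ 2 / 2 * (1 - p))) :=
    differentiable_cosh_sqrt.comp (f := fun p : ℂ => (Real.pi : ℂ) ^ 2 / 2 * (1 - p))
      (by fun_prop)
  exact (h.sub_const 1).differentiableOn.div (h.add_const 1).differentiableOn
    fun p hp => cosh_sqrt_add_one_ne_zero hp

theorem LPInv_one : LPInv 1 = 0 := by simp [LPInv]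

/-- The exponential takes the strip to the right half-plane, which a Cayley transform takes to the
disc; the principal logarithm undoes `exp` on the strip. -/
theorem LPInv_mem_and_LP_LPInv {p : ℂ} (hp : p ∈ parabolaRegion) :
    LPInv p ∈ unitDisc ∧ LP (LPInv p) = p := by
  have hpi : (Real.pi : ℂ) ≠ 0 := by exact_mod_cast Real.pi_ne_zero
  set ζ := Complex.sqrt ((Real.pi : ℂ) ^ 2 / 2 * (1 - p)) with hζdef
  have hζ : ζ ^ 2 = (Real.pi : ℂ) ^ 2 / 2 * (1 - p) := sqrt_sq _
  have him := abs_im_lt_of_mem_parabolaRegion hp hζ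
  have hre := re_exp_pos him
  have hE : exp ζ + 1 ≠ 0 := fun h => by
    have h' := congrArg re h
    simp only [add_re, one_re, zero_re] at h'
    linarith
  have hw : LPInv p = ((exp ζ - 1) / (exp ζ + 1)) ^ 2 :=
    (cosh_sub_one_div_cosh_add_one ζ hE).2
  set s := (exp ζ - 1) / (exp ζ + 1) with hs
  have hs1 : ‖s‖ < 1 := by
    rw [hs, norm_div, div_lt_one (norm_pos_iff.mpr hE)]
    refine lt_of_pow_lt_pow_left₀ 2 (norm_nonneg _) ?_
    rw [sq_norm_eq, sq_norm_eq]
    simp only [sub_re, add_re, one_re, sub_im, add_im, one_im]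
    nlinarith
  have hmem : LPInv p ∈ unitDisc := by
    rw [mem_unitDisc, hw, norm_pow]
    nlinarith [norm_nonneg s]
  refine ⟨hmem, ?_⟩
  have hfrac : (1 + s) / (1 - s) = exp ζ := by
    have h1 := one_sub_ne_zero_of_norm_lt_one hs1
    rw [div_eq_iff h1, hs]
    field_simp
    ring
  have hb := abs_lt.mp him
  have hp0 := Real.pi_pos
  rw [LP, logSq_eq hmem hw.symm, hfrac, log_exp (by linarith) (by linarith), hζ]
  field_simp
  ring

theorem subordinate_LP {p : ℂ → ℂ} (hd : DifferentiableOn ℂ p unitDisc) (h0 : p 0 = 1)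
    (hm : MapsTo p unitDisc parabolaRegion) : Subordinate p LP :=
  ⟨fun z => LPInv (p z), differentiableOn_LPInv.comp hd hm,
    fun _ hz => (LPInv_mem_and_LP_LPInv (hm hz)).1, by simp [h0, LPInv_one],
    fun _ hz => (LPInv_mem_and_LP_LPInv (hm hz)).2.symm⟩

theorem Subordinate.mapsTo_parabolaRegion {p : ℂ → ℂ} (h : Subordinate p LP) :
    MapsTo p unitDisc parabolaRegion := by
  obtain ⟨w, -, hw, -, hp⟩ := h
  intro z hz
  rw [hp z hz]
  exact LP_mem_parabolaRegion (hw hz)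

/-! ### Dilations and the criterion for the sharp radius -/

theorem logQuot_dilate {r : ℝ} (hr : 0 < r) (f : ℂ → ℂ) (z : ℂ) :
    logQuot (dilate r f) z = logQuot f (r * z) := by
  have hr0 : (r : ℂ) ≠ 0 := by exact_mod_cast hr.ne'
  rcases eq_or_ne z 0 with rfl | hz
  · simp [logQuot]
  · have hd : deriv (dilate r f) z = deriv f (r * z) := by
      have : dilate r f = fun z => f ((r : ℂ) * z) / (r : ℂ) := rfl
      rw [this, deriv_div_const, deriv_comp_mul_left, smul_eq_mul]
      field_simp
    simp only [logQuot, hz, hr0, mul_eq_zero, or_self, if_false, hd, dilate]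
    rw [div_div_eq_mul_div]
    ring

theorem real_mul_mem_unitDisc {r : ℝ} (hr : 0 < r) (hr1 : r ≤ 1) {z : ℂ} (hz : z ∈ unitDisc) :
    (r : ℂ) * z ∈ unitDisc := by
  rw [mem_unitDisc] at *
  rw [norm_mul, norm_real, Real.norm_of_nonneg hr.le]
  nlinarith [norm_nonneg z]

theorem dilate_mem_classA {r : ℝ} (hr : 0 < r) (hr1 : r ≤ 1) {f : ℂ → ℂ} (hf : f ∈ classA) :
    dilate r f ∈ classA := by
  have hr0 : (r : ℂ) ≠ 0 := by exact_mod_cast hr.ne'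
  obtain ⟨hd, h0, h1⟩ := hf
  refine ⟨?_, by simp [dilate, h0], ?_⟩
  · exact (hd.comp (f := fun z => (r : ℂ) * z) (by fun_prop)
      fun z hz => real_mul_mem_unitDisc hr hr1 hz).div_const _
  · have : dilate r f = fun z => f ((r : ℂ) * z) / (r : ℂ) := rfl
    rw [this, deriv_div_const, deriv_comp_mul_left, smul_eq_mul, mul_zero, h1]
    field_simp

theorem dilate_noZeros {r : ℝ} (hr : 0 < r) (hr1 : r ≤ 1) {f : ℂ → ℂ} (hf : NoZeros f) :
    NoZeros (dilate r f) := by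
  have hr0 : (r : ℂ) ≠ 0 := by exact_mod_cast hr.ne'
  intro z hz hz0
  exact div_ne_zero (hf _ (real_mul_mem_unitDisc hr hr1 hz) (mul_ne_zero hr0 hz0)) hr0

theorem dilate_mem_FLP {φ f : ℂ → ℂ} {r : ℝ} (hr : 0 < r) (hr1 : r ≤ 1)
    (hφ : DifferentiableOn ℂ φ unitDisc) (hφr : ∀ z, ‖z‖ < r → φ z ∈ parabolaRegion)
    (hf : f ∈ starClass φ) : dilate r f ∈ FLP := by
  obtain ⟨hA, hN, w, hwd, hwm, hw0, hw⟩ := hf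
  have hp : ∀ z ∈ unitDisc, logQuot (dilate r f) z = φ (w (r * z)) := fun z hz => by
    rw [logQuot_dilate hr, hw _ (real_mul_mem_unitDisc hr hr1 hz)]
  refine ⟨dilate_mem_classA hr hr1 hA, dilate_noZeros hr hr1 hN, subordinate_LP ?_ ?_ ?_⟩
  · refine DifferentiableOn.congr ?_ hp
    have h1 : MapsTo (fun z : ℂ => (r : ℂ) * z) unitDisc unitDisc :=
      fun z hz => real_mul_mem_unitDisc hr hr1 hz
    have h2 : DifferentiableOn ℂ (fun z => w (r * z)) unitDisc :=
      hwd.comp (f := fun z : ℂ => (r : ℂ) * z) (by fun_prop) h1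
    exact hφ.comp (f := fun z => w (r * z)) h2 fun z hz => hwm (h1 hz)
  · simp [logQuot]
  · intro z hz
    rw [hp z hz]
    apply hφr
    have hz' := real_mul_mem_unitDisc hr hr1 hz
    have h1 : ‖w (r * z)‖ ≤ ‖(r : ℂ) * z‖ :=
      Complex.norm_le_norm_of_mapsTo_ball hwd
        (fun y hy => Metric.ball_subset_closedBall (hwm hy)) hw0 (mem_unitDisc.mp hz')
    refine lt_of_le_of_lt h1 ?_
    rw [norm_mul, norm_real, Real.norm_of_nonneg hr.le]
    have := mem_unitDisc.mp hz
    nlinarith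

/-- Every holomorphic `φ` with `φ 0 = 1` is the logarithmic quotient of a member of its class. -/
theorem exists_mem_starClass {φ : ℂ → ℂ} (hφ : DifferentiableOn ℂ φ unitDisc) (h0 : φ 0 = 1) :
    ∃ f ∈ starClass φ, ∀ z ∈ unitDisc, logQuot f z = φ z := by
  have hg : DifferentiableOn ℂ (dslope φ 0) unitDisc :=
    (Complex.differentiableOn_dslope (isOpen_unitDisc.mem_nhds zero_mem_unitDisc)).mpr hφ
  -- The function is `z * exp F` with `F' = (φ - 1) / z`; `dslope` fills in the value at the origin.
  obtain ⟨F, hF0, hF⟩ := hg.isExactOn_ball.with_val_at 0 0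
  have hd : ∀ z ∈ unitDisc, HasDerivAt (fun z => z * exp (F z))
      (1 * exp (F z) + z * (exp (F z) * dslope φ 0 z)) z := fun z hz =>
    (hasDerivAt_id z).mul (hF z hz).cexp
  have hq : ∀ z ∈ unitDisc, logQuot (fun z => z * exp (F z)) z = φ z := by
    intro z hz
    rcases eq_or_ne z 0 with rfl | hz0
    · simp [logQuot, h0]
    · have h1 := sub_smul_dslope φ 0 z
      rw [sub_zero, smul_eq_mul, h0] at h1
      have h2 := exp_ne_zero (F z)
      simp only [logQuot, hz0, if_false, (hd z hz).deriv]
      field_simp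
      linear_combination h1
  refine ⟨fun z => z * exp (F z), ⟨⟨fun z hz => (hd z hz).differentiableAt.differentiableWithinAt,
    by simp, by simp [(hd 0 zero_mem_unitDisc).deriv, hF0]⟩,
    fun z _ hz0 => mul_ne_zero hz0 (exp_ne_zero _), id, differentiableOn_id, mapsTo_id _, rfl, hq⟩,
    hq⟩

/-- Criterion for the sharp radius: `φ` maps the disc of radius `R` into the parabolic region, and
sends the boundary point `R` to a point outside the region. -/
theorem isSharpRadius_starClass {φ : ℂ → ℂ} {R : ℝ} (hR : 0 < R) (hR1 : R ≤ 1)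
    (hφ : DifferentiableOn ℂ φ unitDisc) (h0 : φ 0 = 1)
    (hin : ∀ z, ‖z‖ < R → φ z ∈ parabolaRegion)
    (hout : R < 1 → φ R = 3 / 2) : IsSharpRadius FLP (starClass φ) R := by
  refine ⟨⟨hR, hR1, fun r hr hrR f hf => dilate_mem_FLP hr (hrR.trans hR1) hφ
    (fun z hz => hin z (hz.trans_le hrR)) hf⟩, ?_⟩
  rintro R' ⟨hR', hR'1, hall⟩
  by_contra! hlt
  obtain ⟨f, hf, hq⟩ := exists_mem_starClass hφ h0
  have hsub := (hall R' hR' le_rfl f hf).2.2.mapsTo_parabolaRegion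
  -- At this point of the disc the dilated quotient equals `φ R = 3 / 2`, which the open region
  -- omits.
  have hz : ((R / R' : ℝ) : ℂ) ∈ unitDisc := by
    rw [mem_unitDisc, norm_real, Real.norm_of_nonneg (by positivity)]
    exact (div_lt_one hR').mpr hlt
  have h1 := hsub hz
  have h2 : ((R' : ℝ) : ℂ) * ((R / R' : ℝ) : ℂ) = (R : ℂ) := by
    rw [← ofReal_mul, mul_div_cancel₀ _ hR'.ne']
  have h3 : (R : ℂ) ∈ unitDisc := by
    rw [← h2]; exact real_mul_mem_unitDisc hR' hR'1 hz
  rw [logQuot_dilate hR', h2, hq _ h3, hout (hlt.trans_le hR'1)] at h1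
  norm_num [parabolaRegion] at h1

theorem classF_eq_starClass (ψ : ℂ → ℂ) : classF ψ = starClass fun z => 1 + ψ z := by
  ext f
  simp only [classF, starClass, Subordinate, mem_ofPred_eq, sub_eq_iff_eq_add']

/-! ### Discs inside the region, and majorants -/

/-- With `t = u - c`, one has `2u + v² < 2c + 2t + ρ² - t²`, which increases in `t` up to `t = ρ ≤
1`. The bound `1` is the radius of curvature of the parabola at its vertex. -/
theorem mem_parabolaRegion_of_norm_lt {c ρ : ℝ} (hρ : ρ ≤ 1) (hc : c + ρ ≤ 3 / 2) {w : ℂ}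
    (hw : ‖w - c‖ < ρ) : w ∈ parabolaRegion := by
  have h1 := sq_norm_eq (w - c)
  simp only [sub_re, sub_im, ofReal_re, ofReal_im, sub_zero] at h1
  have h2 := (abs_le.mp (abs_re_le_norm (w - c))).2
  simp only [sub_re, ofReal_re] at h2
  have h3 := norm_nonneg (w - c)
  rw [mem_parabolaRegion]
  nlinarith

theorem mem_parabolaRegion_of_norm_sub_one_lt {w : ℂ} (hw : ‖w - 1‖ < 1 / 2) :
    w ∈ parabolaRegion :=
  mem_parabolaRegion_of_norm_lt (c := 1) (ρ := 1 / 2) (by norm_num) (by norm_num)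
    (by rwa [ofReal_one])

open scoped ComplexOrder in
theorem sqrt_ofReal_sq {x : ℝ} (hx : 0 ≤ x) : Complex.sqrt ((x : ℂ) ^ 2) = x := by
  have h : (0 : ℂ) ≤ (x : ℂ) ^ 2 := by exact_mod_cast sq_nonneg x
  rw [Complex.sqrt_of_nonneg h]
  norm_cast
  exact Real.sqrt_sq hx

theorem re_sqrt_nonneg (z : ℂ) : 0 ≤ (Complex.sqrt z).re := by
  rw [Complex.sqrt, cpow_inv_two_re]
  exact Real.sqrt_nonneg _

theorem norm_sinh_le (z : ℂ) : ‖sinh z‖ ≤ Real.sinh ‖z‖ := by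
  refine (hasSum_sinh z).norm_le_of_bounded (Real.hasSum_sinh ‖z‖) fun n => ?_
  simp

theorem norm_cosh_sub_one_le (z : ℂ) : ‖cosh z - 1‖ ≤ Real.cosh ‖z‖ - 1 := by
  have h1 : cosh z - 1 = 2 * sinh (z / 2) ^ 2 := by
    have h := cosh_two_mul (z / 2)
    rw [mul_div_cancel₀ _ two_ne_zero, cosh_sq] at h
    rw [h]; ring
  have h2 : Real.cosh ‖z‖ - 1 = 2 * Real.sinh (‖z‖ / 2) ^ 2 := by
    have h := Real.cosh_two_mul (‖z‖ / 2)
    rw [mul_div_cancel₀ _ two_ne_zero, Real.cosh_sq] at h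
    rw [h]; ring
  have h3 := norm_sinh_le (z / 2)
  rw [norm_div, Complex.norm_ofNat] at h3
  rw [h1, h2, norm_mul, norm_pow, Complex.norm_ofNat]
  gcongr

theorem norm_exp_sub_one_le_exp_norm (z : ℂ) : ‖exp z - 1‖ ≤ Real.exp ‖z‖ - 1 := by
  simpa using norm_exp_sub_sum_le_exp_norm_sub_sum z 1

/-- The even terms of the two logarithm series cancel and the odd ones add, leaving coefficients `0`
or `2 / n`. -/
theorem norm_log_one_add_sub_log_one_sub_le {s : ℂ} (hs : ‖s‖ < 1) :
    ‖log (1 + s) - log (1 - s)‖ ≤ Real.log (1 + ‖s‖) - Real.log (1 - ‖s‖) := by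
  have hs' : ‖((‖s‖ : ℝ) : ℂ)‖ < 1 := by simpa using hs
  have h1 := (hasSum_taylorSeries_log hs).add (hasSum_taylorSeries_neg_log hs)
  have h2 := (hasSum_taylorSeries_log hs').add (hasSum_taylorSeries_neg_log hs')
  have h3 : log (1 + ((‖s‖ : ℝ) : ℂ)) + -log (1 - ((‖s‖ : ℝ) : ℂ)) =
      ((Real.log (1 + ‖s‖) - Real.log (1 - ‖s‖) : ℝ) : ℂ) := by
    rw [ofReal_sub, ofReal_log (by positivity), ofReal_log (by linarith)]
    push_cast; ring
  rw [h3] at h2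
  have h4 : HasSum (fun n : ℕ => ((-1) ^ (n + 1) + 1) * ‖s‖ ^ n / (n : ℝ))
      (Real.log (1 + ‖s‖) - Real.log (1 - ‖s‖)) := by
    rw [← Complex.hasSum_ofReal]
    convert h2 using 2 with n
    push_cast; ring
  rw [sub_eq_add_neg]
  refine h1.norm_le_of_bounded h4 fun n => ?_
  have h5 : ((-1 : ℂ)) ^ (n + 1) * s ^ n / n + s ^ n / n =
      (((-1) ^ (n + 1) + 1 : ℝ) : ℂ) * s ^ n / n := by push_cast; ring
  have h6 : (0 : ℝ) ≤ (-1) ^ (n + 1) + 1 := by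
    rcases neg_one_pow_eq_or ℝ (n + 1) with h | h <;> rw [h] <;> norm_num
  rw [h5, norm_div, norm_mul, norm_pow, norm_real, Real.norm_of_nonneg h6, norm_natCast]

/-! ### Classes handled by direct bounds on `|φ - 1|` -/

theorem isSharpRadius_Sp : IsSharpRadius FLP Sp (Real.tanh (Real.pi / 4) ^ 2) := by
  have hpi := Real.pi_pos
  have hpi' : (Real.pi : ℂ) ≠ 0 := by exact_mod_cast hpi.ne'
  set t := Real.tanh (Real.pi / 4) with ht
  have ht0 : 0 < t := by
    rw [ht, Real.tanh_eq_sinh_div_cosh]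
    exact div_pos (Real.sinh_pos_iff.mpr (by positivity)) (Real.cosh_pos _)
  have ht1 : t < 1 := Real.tanh_lt_one _
  -- This is `artanh t = π / 4`; then `2 / π² * (π / 2)² = 1 / 2`.
  have hlog : Real.log (1 + t) - Real.log (1 - t) = Real.pi / 2 := by
    have h := Real.artanh_tanh (Real.pi / 4)
    rw [← ht, Real.artanh_eq_half_log ⟨by linarith, ht1.le⟩,
      Real.log_div (by linarith) (by linarith)] at h
    linarith
  refine isSharpRadius_starClass (by positivity) (by nlinarith)
    ((differentiableOn_logSq.const_mul _).const_add 1) (by simp [logSq]) (fun z hz => ?_)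
    fun _ => ?_
  · apply mem_parabolaRegion_of_norm_sub_one_lt
    set s := Complex.sqrt z with hs
    have hst : ‖s‖ < t := by
      have := norm_sqrt_sq z
      exact lt_of_pow_lt_pow_left₀ 2 ht0.le (by rw [this]; exact hz)
    have hs1 := hst.trans ht1
    have h1 := norm_log_one_add_sub_log_one_sub_le hs1
    have h2 := Real.log_lt_log (by positivity) (add_lt_add_right hst 1)
    have h3 : Real.log (1 - t) < Real.log (1 - ‖s‖) :=
      Real.log_lt_log (by linarith) (by linarith)
    have h4 : ‖log ((1 + s) / (1 - s))‖ < Real.pi / 2 := by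
      rw [log_one_add_div_one_sub hs1]; linarith
    rw [add_sub_cancel_left, logSq, ← hs, norm_mul, norm_div, norm_pow, norm_pow, norm_real,
      Complex.norm_ofNat, Real.norm_of_nonneg hpi.le, div_mul_eq_mul_div,
      div_lt_iff₀ (by positivity)]
    nlinarith [norm_nonneg (log ((1 + s) / (1 - s)))]
  · have h1 : logSq ((t ^ 2 : ℝ) : ℂ) = ((Real.pi / 2 : ℝ) : ℂ) ^ 2 := by
      rw [logSq, ofReal_pow, sqrt_ofReal_sq ht0.le, ← hlog,
        ← Real.log_div (by linarith) (by linarith), ofReal_log]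
      · push_cast; rfl
      · exact div_nonneg (by linarith) (by linarith)
    simp only [h1]
    push_cast
    field_simp
    norm_num

theorem isSharpRadius_Svarrho : IsSharpRadius FLP Svarrho (Real.arcosh (3 / 2) ^ 2) := by
  set a := Real.arcosh (3 / 2) with ha
  have hc : Real.cosh a = 3 / 2 := Real.cosh_arcosh (by norm_num)
  have ha0 : 0 < a := Real.arcosh_pos (by norm_num)
  have ha1 : a < 1 := by
    rw [← abs_of_pos ha0, ← abs_one (α := ℝ), ← Real.cosh_lt_cosh, hc]
    have h1 := Real.exp_one_gt_d9
    have h2 := Real.exp_neg 1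
    have h3 : (1 / 3 : ℝ) < (Real.exp 1)⁻¹ := by
      rw [← one_div]
      exact one_div_lt_one_div_of_lt (Real.exp_pos 1) (by linarith [Real.exp_one_lt_d9])
    rw [Real.cosh_eq, h2]
    linarith
  refine isSharpRadius_starClass (by positivity) (by nlinarith)
    differentiable_cosh_sqrt.differentiableOn (by simp) (fun z hz => ?_) fun _ => ?_
  · apply mem_parabolaRegion_of_norm_sub_one_lt
    have h1 : ‖Complex.sqrt z‖ < a :=
      lt_of_pow_lt_pow_left₀ 2 ha0.le (by rw [norm_sqrt_sq]; exact hz)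
    have h2 : Real.cosh ‖Complex.sqrt z‖ < Real.cosh a :=
      Real.cosh_lt_cosh.mpr (by rwa [abs_of_nonneg (norm_nonneg _), abs_of_pos ha0])
    linarith [norm_cosh_sub_one_le (Complex.sqrt z)]
  · rw [ofReal_pow, sqrt_ofReal_sq ha0.le, ← ofReal_cosh, hc]
    norm_num

theorem exists_isSharpRadius_Swp : ∃ R : ℝ, R * Real.exp R = 1 / 2 ∧ 0.3517 < R ∧ R < 0.3518 ∧
    IsSharpRadius FLP Swp R := by
  have hcont : ContinuousOn (fun x : ℝ => x * Real.exp x) (Icc 0.3517 0.3518) := by fun_prop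
  -- Eight Taylor terms certify both signs needed for the intermediate value theorem.
  have hlo : (0.3517 : ℝ) * Real.exp 0.3517 < 1 / 2 := by
    have h := Real.exp_bound' (x := 0.3517) (n := 8) (by norm_num) (by norm_num) (by norm_num)
    norm_num [Finset.sum_range_succ, Nat.factorial] at h ⊢
    linarith
  have hhi : 1 / 2 < (0.3518 : ℝ) * Real.exp 0.3518 := by
    have h := Real.sum_le_exp_of_nonneg (x := 0.3518) (by norm_num) 8
    norm_num [Finset.sum_range_succ, Nat.factorial] at h ⊢
    linarith
  obtain ⟨R, ⟨hR1, hR2⟩, hR⟩ := intermediate_value_Ioo (by norm_num) hcont ⟨hlo, hhi⟩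
  have hR' : R * Real.exp R = 1 / 2 := hR
  have hR0 : 0 < R := by linarith
  refine ⟨R, hR, hR1, hR2, isSharpRadius_starClass hR0 (by linarith)
    (Differentiable.differentiableOn (by fun_prop)) (by simp) (fun z hz => ?_) fun _ => ?_⟩
  · apply mem_parabolaRegion_of_norm_sub_one_lt
    rw [add_sub_cancel_left, norm_mul, ← hR']
    have h1 : ‖exp z‖ ≤ Real.exp R := (norm_exp_le_exp_norm z).trans (by gcongr)
    exact mul_lt_mul hz h1 (norm_pos_iff.mpr (exp_ne_zero z)) hR0.le
  · rw [← ofReal_exp, ← ofReal_mul, hR']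
    norm_num

theorem isSharpRadius_Sexp {α : ℝ} (h1 : α < 1) :
    IsSharpRadius FLP (Sexp α) (if α < 1 - 1 / (2 * (Real.exp 1 - 1)) then
      Real.log (1 - 1 / (2 * (α - 1))) else 1) := by
  have he := Real.exp_one_gt_d9
  -- The threshold decides whether `(1 - α)(exp r - 1)` reaches `1 / 2` before `r = 1`.
  have hcrit : α < 1 - 1 / (2 * (Real.exp 1 - 1)) ↔ 1 < 2 * (1 - α) * (Real.exp 1 - 1) := by
    rw [lt_sub_comm, div_lt_iff₀ (by linarith)]
    constructor <;> intro h <;> linarith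
  have hrad : 1 - 1 / (2 * (α - 1)) = 1 + 1 / (2 * (1 - α)) := by
    rw [show 2 * (α - 1) = -(2 * (1 - α)) by ring, div_neg]; ring
  have hpos : 0 < 1 / (2 * (1 - α)) := div_pos one_pos (by linarith)
  have hdiff : DifferentiableOn ℂ (fun z => (α : ℂ) + (1 - (α : ℂ)) * exp z) unitDisc :=
    Differentiable.differentiableOn (by fun_prop)
  have hin : ∀ z : ℂ, (1 - α) * (Real.exp ‖z‖ - 1) < 1 / 2 →
      (α : ℂ) + (1 - (α : ℂ)) * exp z ∈ parabolaRegion := fun z hz => by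
    apply mem_parabolaRegion_of_norm_sub_one_lt
    have h : (α : ℂ) + (1 - (α : ℂ)) * exp z - 1 = ((1 - α : ℝ) : ℂ) * (exp z - 1) := by
      push_cast; ring
    rw [h, norm_mul, norm_real, Real.norm_of_nonneg (by linarith)]
    refine lt_of_le_of_lt ?_ hz
    exact mul_le_mul_of_nonneg_left (norm_exp_sub_one_le_exp_norm z) (by linarith)
  rw [hrad]
  split_ifs with hα
  · rw [hcrit] at hα
    have hexp : Real.exp (Real.log (1 + 1 / (2 * (1 - α)))) = 1 + 1 / (2 * (1 - α)) :=
      Real.exp_log (by linarith)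
    have hval : (1 - α) * (1 + 1 / (2 * (1 - α)) - 1) = 1 / 2 := by
      have : 1 - α ≠ 0 := by linarith
      field_simp
      ring
    refine isSharpRadius_starClass (Real.log_pos (by linarith)) ?_ hdiff (by simp)
      (fun z hz => hin z ?_) fun _ => ?_
    · rw [← Real.exp_le_exp, hexp, ← le_sub_iff_add_le', div_le_iff₀ (by linarith)]
      linarith
    · rw [← hval]
      have := Real.exp_lt_exp.mpr hz
      rw [hexp] at this
      exact mul_lt_mul_of_pos_left (by linarith) (by linarith)
    · rw [← ofReal_exp, hexp]
      have := congrArg ofReal hval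
      push_cast at this ⊢
      linear_combination this
  · rw [hcrit, not_lt] at hα
    refine isSharpRadius_starClass one_pos le_rfl hdiff (by simp) (fun z hz => hin z ?_)
      fun h => absurd h (lt_irrefl 1)
    have := Real.exp_lt_exp.mpr hz
    nlinarith

theorem isSharpRadius_Se : IsSharpRadius FLP Se (Real.log (3 / 2)) := by
  have h := isSharpRadius_Sexp (α := 0) one_pos
  have he := Real.exp_one_gt_d9
  have hcrit : (0 : ℝ) < 1 - 1 / (2 * (Real.exp 1 - 1)) := by
    rw [sub_pos, div_lt_one (by linarith)]
    linarith
  have hS : Sexp 0 = Se := by simp [Sexp, Se]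
  rw [if_pos hcrit, hS] at h
  norm_num at h ⊢
  exact h

theorem isSharpRadius_BS {α : ℝ} (h0 : 0 ≤ α) (h1 : α < 1) :
    IsSharpRadius FLP (BS α) (if α = 0 then 1 / 2 else (Real.sqrt (1 + α) - 1) / α) := by
  obtain ⟨R, hRdef⟩ : ∃ R, R = if α = 0 then 1 / 2 else (Real.sqrt (1 + α) - 1) / α := ⟨_, rfl⟩
  -- The equation says `R / (1 - α R²) = 1 / 2` and covers `α = 0` as well.
  have hR : 0 < R ∧ α * R ^ 2 + 2 * R = 1 := by
    rw [hRdef]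
    split_ifs with h
    · subst h; norm_num
    · have hα : 0 < α := lt_of_le_of_ne h0 (Ne.symm h)
      have hs : 1 < Real.sqrt (1 + α) := Real.lt_sqrt_of_sq_lt (by linarith)
      have hsq : Real.sqrt (1 + α) ^ 2 = 1 + α := Real.sq_sqrt (by linarith)
      refine ⟨div_pos (by linarith) hα, ?_⟩
      field_simp
      linear_combination hsq
  rw [← hRdef, BS, classF_eq_starClass]
  obtain ⟨hR0, hR⟩ := hR
  have hR1 : R < 1 := by nlinarith
  have hden : ∀ z : ℂ, 1 - α * ‖z‖ ^ 2 ≤ ‖1 - (α : ℂ) * z ^ 2‖ := fun z => by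
    have h := norm_sub_norm_le (1 : ℂ) ((α : ℂ) * z ^ 2)
    rwa [norm_one, norm_mul, norm_pow, norm_real, Real.norm_of_nonneg h0] at h
  have hdpos : ∀ z : ℂ, ‖z‖ < 1 → 0 < 1 - α * ‖z‖ ^ 2 := fun z hz => by
    nlinarith [norm_nonneg z]
  refine isSharpRadius_starClass hR0 hR1.le ?_ (by simp) (fun z hz => ?_) fun _ => ?_
  · refine (DifferentiableOn.div (by fun_prop) (by fun_prop) fun z hz => ?_).const_add 1
    exact norm_pos_iff.mp ((hdpos z (mem_unitDisc.mp hz)).trans_le (hden z))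
  · apply mem_parabolaRegion_of_norm_sub_one_lt
    have hp := hdpos z (hz.trans hR1)
    rw [add_sub_cancel_left, norm_div, div_lt_iff₀ (hp.trans_le (hden z))]
    have h2 : α * ‖z‖ ^ 2 ≤ α * R ^ 2 := by gcongr
    linarith [hden z]
  · have h2 : (α : ℂ) * R ^ 2 + 2 * R = 1 := by exact_mod_cast hR
    have h3 : 1 - (α : ℂ) * R ^ 2 = 2 * R := by linear_combination -h2
    have h4 : (R : ℂ) ≠ 0 := by exact_mod_cast hR0.ne'
    rw [h3]
    field_simp
    norm_num

/-! ### Janowski functions -/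

theorem janowski_mem_parabolaRegion {A B r : ℝ} (hB : -1 < B) (hBA : B < A) (hA : A ≤ 1)
    (hr : 0 < r) (hr1 : r ≤ 1) (hr2 : (2 * A - 3 * B) * r ≤ 1) {z : ℂ} (hz : ‖z‖ < r) :
    (1 + (A : ℂ) * z) / (1 + (B : ℂ) * z) ∈ parabolaRegion := by
  have hm : 0 < 1 - B * r := by nlinarith
  have hp : 0 < 1 + B * r := by nlinarith
  have hmp : 0 < 1 - B ^ 2 * r ^ 2 := by nlinarith
  have hc1 : (1 - A * B * r ^ 2) / (1 - B ^ 2 * r ^ 2) + (A - B) * r / (1 - B ^ 2 * r ^ 2) =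
      (1 + A * r) / (1 + B * r) := by
    rw [show 1 - B ^ 2 * r ^ 2 = (1 - B * r) * (1 + B * r) by ring]
    field_simp
    ring
  have hc2 : (1 - A * B * r ^ 2) / (1 - B ^ 2 * r ^ 2) - (A - B) * r / (1 - B ^ 2 * r ^ 2) =
      (1 - A * r) / (1 - B * r) := by
    rw [show 1 - B ^ 2 * r ^ 2 = (1 - B * r) * (1 + B * r) by ring]
    field_simp
    ring
  -- The image of `|z| < r` is a disc with real diameter between the two quotients. Its ends lie in
  -- `[-1/2, 3/2]`, so its radius is at most `1`.
  have hup : (1 + A * r) / (1 + B * r) ≤ 3 / 2 := by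
    rw [div_le_iff₀ hp]; linarith
  have hlow : -(1 / 2) ≤ (1 - A * r) / (1 - B * r) := by
    rw [le_div_iff₀ hm]; nlinarith
  refine mem_parabolaRegion_of_norm_lt (c := (1 - A * B * r ^ 2) / (1 - B ^ 2 * r ^ 2))
    (ρ := (A - B) * r / (1 - B ^ 2 * r ^ 2)) (by linarith) (by linarith) ?_
  have hN := sq_norm_eq z
  -- The difference of the two sides is `(r² - |z|²)(1 - B² r²)`.
  have hsq : ‖z + ((B * r ^ 2 : ℝ) : ℂ)‖ ^ 2 < (r * ‖1 + (B : ℂ) * z‖) ^ 2 := by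
    rw [mul_pow, sq_norm_eq, sq_norm_eq (1 + (B : ℂ) * z)]
    simp only [add_re, add_im, one_re, one_im, ofReal_re, ofReal_im, mul_re, mul_im, zero_mul,
      sub_zero, add_zero, zero_add]
    have h1 : 0 < (r ^ 2 - ‖z‖ ^ 2) * (1 - B ^ 2 * r ^ 2) :=
      mul_pos (by nlinarith [norm_nonneg z]) hmp
    rw [hN] at h1
    linarith
  have hlt := lt_of_pow_lt_pow_left₀ 2 (by positivity) hsq
  have hd : 0 < ‖1 + (B : ℂ) * z‖ := by
    by_contra h
    have h' : ‖1 + (B : ℂ) * z‖ = 0 := le_antisymm (not_lt.mp h) (norm_nonneg _)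
    rw [h', mul_zero] at hlt
    exact absurd hlt (not_lt.mpr (norm_nonneg _))
  have hd' : 1 + (B : ℂ) * z ≠ 0 := norm_pos_iff.mp hd
  have hmp' : (1 - (B : ℂ) ^ 2 * r ^ 2) ≠ 0 := by exact_mod_cast hmp.ne'
  have hkey : (1 + (A : ℂ) * z) / (1 + (B : ℂ) * z) -
      (((1 - A * B * r ^ 2) / (1 - B ^ 2 * r ^ 2) : ℝ) : ℂ) =
      (((A - B) / (1 - B ^ 2 * r ^ 2) : ℝ) : ℂ) *
        ((z + ((B * r ^ 2 : ℝ) : ℂ)) / (1 + (B : ℂ) * z)) := by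
    push_cast
    rw [div_sub_div _ _ hd' hmp', div_mul_div_comm, div_eq_div_iff (mul_ne_zero hd' hmp')
      (mul_ne_zero hmp' hd')]
    ring
  rw [hkey, norm_mul, norm_div, norm_real,
    Real.norm_of_nonneg (div_nonneg (by linarith) hmp.le), mul_div_right_comm]
  refine mul_lt_mul_of_pos_left ?_ (div_pos (by linarith) hmp)
  rwa [div_lt_iff₀ hd]

theorem isSharpRadius_Janowski {A B r : ℝ} (hB : -1 < B) (hBA : B < A) (hA : A ≤ 1)
    (hr : 0 < r) (hr1 : r ≤ 1) (hr2 : (2 * A - 3 * B) * r ≤ 1)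
    (hr3 : r < 1 → (2 * A - 3 * B) * r = 1) : IsSharpRadius FLP (Janowski A B) r := by
  refine isSharpRadius_starClass hr hr1 ?_ (by simp)
    (fun z hz => janowski_mem_parabolaRegion hB hBA hA hr hr1 hr2 hz) fun h => ?_
  · refine DifferentiableOn.div (by fun_prop) (by fun_prop) fun z hz h => ?_
    rw [mem_unitDisc] at hz
    have h1 : (B : ℂ) * z = -1 := by linear_combination h
    have h2 := congrArg norm h1
    rw [norm_mul, norm_neg, norm_one, norm_real, Real.norm_eq_abs] at h2
    have h3 : |B| < 1 := abs_lt.mpr ⟨hB, by linarith⟩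
    nlinarith [norm_nonneg z, abs_nonneg B]
  · have h1 : (2 * (A : ℂ) - 3 * B) * r = 1 := by exact_mod_cast hr3 h
    have h2 : 1 + (B : ℂ) * r ≠ 0 := by
      have : 1 + B * r ≠ 0 := by nlinarith
      exact_mod_cast this
    rw [div_eq_iff h2]
    linear_combination h1 / 2

/-! ### The function `z + √(1 + z²)` -/

theorem add_sqrt_mul_sqrt_sub (z : ℂ) :
    (z + Complex.sqrt (1 + z ^ 2)) * (Complex.sqrt (1 + z ^ 2) - z) = 1 := by
  linear_combination sqrt_sq (1 + z ^ 2)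

theorem one_add_sq_mem_slitPlane {z : ℂ} (hz : ‖z‖ < 1) : 1 + z ^ 2 ∈ slitPlane := by
  left
  have h1 := (abs_le.mp (abs_re_le_norm (z ^ 2))).1
  rw [norm_pow] at h1
  rw [add_re, one_re]
  nlinarith [norm_nonneg z]

/-- A crude bound, used to get `|w - 1| < 1` for `|z| < 5/12`. -/
theorem norm_add_sqrt_sub_one_le (z : ℂ) :
    ‖z + Complex.sqrt (1 + z ^ 2) - 1‖ ≤ ‖z‖ + ‖z‖ ^ 2 := by
  set u := Complex.sqrt (1 + z ^ 2) with hu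
  have h1 : 1 ≤ ‖u + 1‖ := by
    have h := re_le_norm (u + 1)
    rw [add_re, one_re] at h
    linarith [re_sqrt_nonneg (1 + z ^ 2)]
  have h2 : ‖u - 1‖ * ‖u + 1‖ = ‖z‖ ^ 2 := by
    rw [← norm_mul, ← norm_pow]
    congr 1
    linear_combination sqrt_sq (1 + z ^ 2)
  have h3 : ‖u - 1‖ ≤ ‖z‖ ^ 2 := by nlinarith [norm_nonneg (u - 1)]
  calc ‖z + u - 1‖ = ‖z + (u - 1)‖ := by rw [add_sub_assoc]
    _ ≤ ‖z‖ + ‖u - 1‖ := norm_add_le _ _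
    _ ≤ _ := by gcongr

/-- The factors `u + z` and `u - z` are inverse to each other, so their real parts have the same
sign, while the sum `2 Re u` is positive. -/
theorem re_add_sqrt_pos {z : ℂ} (hz : ‖z‖ < 1) : 0 < (z + Complex.sqrt (1 + z ^ 2)).re := by
  set u := Complex.sqrt (1 + z ^ 2) with hu
  have h1 := add_sqrt_mul_sqrt_sub z
  have hu0 : 0 < u.re := by
    refine lt_of_le_of_ne (re_sqrt_nonneg _) fun h => ?_
    have h2 := congrArg re (sqrt_sq (1 + z ^ 2))
    rw [← hu, sq, mul_re, ← h] at h2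
    have h3 := (abs_le.mp (abs_re_le_norm (z ^ 2))).1
    rw [norm_pow] at h3
    rw [add_re, one_re] at h2
    nlinarith [norm_nonneg z, sq_nonneg u.im]
  by_contra hneg
  have hre := congrArg re h1
  have him := congrArg im h1
  rw [← hu] at hre him
  simp only [mul_re, mul_im, one_re, one_im] at hre him
  set a := (z + u).re
  set b := (z + u).im
  set c := (u - z).re with hc
  have hsum : a + c = 2 * u.re := by simp only [a, c, add_re, sub_re]; ring
  have h4 : (a ^ 2 + b ^ 2) * c = a := by linear_combination a * hre + b * him
  have hc0 : 0 < c := by linarith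
  have hN : 0 < a ^ 2 + b ^ 2 := by
    refine lt_of_le_of_ne (by positivity) fun h => ?_
    have ha : a = 0 := by nlinarith [sq_nonneg a, sq_nonneg b]
    have hb : b = 0 := by nlinarith [sq_nonneg a, sq_nonneg b]
    rw [ha, hb] at hre
    norm_num at hre
  linarith [mul_pos hN hc0]

theorem isSharpRadius_DeltaStar : IsSharpRadius FLP DeltaStar (5 / 12) := by
  refine isSharpRadius_starClass (by norm_num) (by norm_num) ?_ (by simp) (fun z hz => ?_)
    fun _ => ?_
  · intro z hz
    have h := differentiableAt_sqrt (one_add_sq_mem_slitPlane (mem_unitDisc.mp hz))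
    exact (differentiableAt_id.add (DifferentiableAt.fun_comp' z h
      (by fun_prop))).differentiableWithinAt
  · apply mem_parabolaRegion_of_norm_sub_one_lt
    have h1 := norm_add_sqrt_sub_one_le z
    have h2 := add_sqrt_mul_sqrt_sub z
    set w := z + Complex.sqrt (1 + z ^ 2) with hw
    set v := Complex.sqrt (1 + z ^ 2) - z with hv
    -- Here `v = 1 / w` and `w - v = 2z`, so `2|z| = d |1 + v|`. On `|w - 1| = d < 1` one has `Re v
    -- ≥ 1 / (1 + d)`, hence `2|z| ≥ d (2 + d) / (1 + d)`, which is at least `5 / 6` once `d ≥ 1 /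
    -- 2`.
    by_contra! hd
    set d := ‖w - 1‖ with hd'
    have hd1 : d < 1 := by nlinarith [norm_nonneg z]
    have h3 : 2 * ‖z‖ = d * ‖1 + v‖ := by
      rw [hd', ← norm_mul, ← Complex.norm_ofNat, ← norm_mul]
      congr 1
      have : w - v = 2 * z := by rw [hw, hv]; ring
      linear_combination -this - h2
    have h4 : 1 + v.re ≤ ‖1 + v‖ := by simpa using re_le_norm (1 + v)
    have hre := congrArg re h2
    have him := congrArg im h2
    simp only [mul_re, mul_im, one_re, one_im] at hre him
    have h5 : (w.re ^ 2 + w.im ^ 2) * v.re = w.re := by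
      linear_combination w.re * hre + w.im * him
    have h6 := sq_norm_eq (w - 1)
    have h7 := (abs_le.mp (abs_re_le_norm (w - 1))).2
    rw [← hd'] at h6 h7
    simp only [sub_re, sub_im, one_re, one_im, sub_zero] at h6 h7
    have h8 : w.re ^ 2 + w.im ^ 2 = d ^ 2 - 1 + 2 * w.re := by linear_combination -h6
    have hw0 : 0 < w.re ^ 2 + w.im ^ 2 := by
      have h9 := (abs_le.mp (abs_re_le_norm (w - 1))).1
      simp only [sub_re, one_re] at h9
      have : 0 < w.re := by linarith
      positivity
    have h10 : 1 ≤ v.re * (1 + d) := by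
      have : (w.re ^ 2 + w.im ^ 2) * 1 ≤ (w.re ^ 2 + w.im ^ 2) * (v.re * (1 + d)) := by
        rw [← mul_assoc, h5, h8]
        nlinarith
      exact le_of_mul_le_mul_left this hw0
    have h11 : 1 + v.re < 5 / 3 := by nlinarith
    nlinarith
  · have h : (1 : ℂ) + ((5 / 12 : ℝ) : ℂ) ^ 2 = ((13 / 12 : ℝ) : ℂ) ^ 2 := by norm_num
    rw [h, sqrt_ofReal_sq (by norm_num)]
    norm_num

/-! ### The function `1 + sinh⁻¹ z` -/

theorem differentiableOn_arsinhC : DifferentiableOn ℂ arsinhC unitDisc := by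
  intro z hz
  rw [mem_unitDisc] at hz
  have h := differentiableAt_sqrt (one_add_sq_mem_slitPlane hz)
  have h1 : DifferentiableAt ℂ (fun z => z + Complex.sqrt (1 + z ^ 2)) z :=
    differentiableAt_id.add (DifferentiableAt.fun_comp' z h (by fun_prop))
  exact (h1.clog (Or.inl (re_add_sqrt_pos hz))).differentiableWithinAt

theorem sinh_arsinhC (z : ℂ) : sinh (arsinhC z) = z := by
  have h1 := add_sqrt_mul_sqrt_sub z
  have h2 : z + Complex.sqrt (1 + z ^ 2) ≠ 0 := left_ne_zero_of_mul_eq_one h1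
  rw [sinh, exp_neg, arsinhC, exp_log h2, inv_eq_of_mul_eq_one_right h1]
  ring

theorem sq_norm_sinh (z : ℂ) : ‖sinh z‖ ^ 2 = Real.sinh z.re ^ 2 + Real.sin z.im ^ 2 := by
  conv_lhs => rw [← re_add_im z, sinh_add, sinh_mul_I, cosh_mul_I]
  rw [sq_norm_eq]
  simp only [← ofReal_sinh, ← ofReal_cosh, ← ofReal_sin, ← ofReal_cos, add_re, add_im, mul_re,
    mul_im, ofReal_re, ofReal_im, I_re, I_im, mul_zero, zero_mul, sub_zero, mul_one, add_zero,
    zero_add]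
  have h1 := Real.cosh_sq z.re
  have h2 := Real.sin_sq_add_cos_sq z.im
  linear_combination Real.sin z.im ^ 2 * h1 + Real.sinh z.re ^ 2 * h2

theorem sinh_one_lt : Real.sinh 1 < 1.1754 := by
  have h1 := Real.exp_one_lt_d9
  have h2 : (0.3678 : ℝ) < (Real.exp 1)⁻¹ := by
    rw [lt_inv_comm₀ (by norm_num) (Real.exp_pos 1)]
    linarith
  rw [Real.sinh_eq, Real.exp_neg]
  linarith

theorem sinh_half_lt : Real.sinh (1 / 2) < 0.53 := by
  have h1 := Real.sinh_two_mul (1 / 2)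
  have h2 := Real.cosh_sq (1 / 2)
  have h3 := sinh_one_lt
  rw [mul_one_div_cancel two_ne_zero] at h1
  by_contra! h
  have h4 : (1.13 : ℝ) ≤ Real.cosh (1 / 2) := by
    by_contra! h5
    nlinarith [Real.cosh_pos (1 / 2)]
  nlinarith

theorem sinh_le_mul {x : ℝ} (h0 : 0 ≤ x) (h1 : x ≤ 1 / 2) : Real.sinh x ≤ 1.1 * x := by
  have hx : |x| ≤ 1 := by rw [abs_of_nonneg h0]; linarith
  have h2 := (abs_le.mp (Real.exp_bound hx (n := 3) (by norm_num))).2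
  have h3 := (abs_le.mp (Real.exp_bound (x := -x) (by rwa [abs_neg]) (n := 3) (by norm_num))).1
  rw [abs_neg] at h3
  rw [abs_of_nonneg h0] at h2 h3
  norm_num [Finset.sum_range_succ, Nat.factorial] at h2 h3
  rw [Real.sinh_eq]
  have h4 : x ^ 3 ≤ x * (1 / 4) := by
    rw [pow_succ']
    gcongr
    nlinarith
  linarith

theorem two_thirds_mul_sq_le_sin_sq {t : ℝ} (h0 : 0 ≤ t) (h1 : t ≤ 1) :
    2 / 3 * t ^ 2 ≤ Real.sin t ^ 2 := by
  have h2 := Real.sin_ge_sub_cube h0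
  have h3 : 0 ≤ t - t ^ 3 / 6 := by nlinarith [sq_nonneg t, mul_nonneg h0 (sq_nonneg t)]
  have h4 : (t - t ^ 3 / 6) ^ 2 ≤ Real.sin t ^ 2 := by gcongr
  have h5 : (t - t ^ 3 / 6) ^ 2 = t ^ 2 * (1 - t ^ 2 / 3) + t ^ 6 / 36 := by ring
  have h6 : t ^ 2 * (2 / 3) ≤ t ^ 2 * (1 - t ^ 2 / 3) := by
    gcongr
    nlinarith
  have : 0 ≤ t ^ 6 / 36 := by positivity
  linarith

theorem sinh_sq_sub_sinh_sq (a b : ℝ) :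
    Real.sinh a ^ 2 - Real.sinh b ^ 2 = Real.sinh (a + b) * Real.sinh (a - b) := by
  rw [Real.sinh_add, Real.sinh_sub]
  linear_combination -Real.sinh a ^ 2 * Real.cosh_sq b + Real.sinh b ^ 2 * Real.cosh_sq a

/-- On the part of the strip `|Im ζ| < π / 2` outside the shifted parabola, `|sinh|` is at least
`sinh (1 / 2)`. -/
theorem sinh_half_sq_le {a b : ℝ} (hb : |b| < Real.pi / 2) (h : 1 ≤ 2 * a + b ^ 2) :
    Real.sinh (1 / 2) ^ 2 ≤ Real.sinh a ^ 2 + Real.sin b ^ 2 := by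
  rcases le_or_gt (1 / 2) a with ha | ha
  · have h1 : Real.sinh (1 / 2) ≤ Real.sinh a := Real.sinh_le_sinh.mpr ha
    have h2 : 0 ≤ Real.sinh (1 / 2) := Real.sinh_nonneg_iff.mpr (by norm_num)
    nlinarith [sq_nonneg (Real.sin b)]
  · have hbs : Real.sin b ^ 2 = Real.sin |b| ^ 2 := by
      rcases abs_choice b with h' | h' <;> simp [h']
    have hmono : ∀ t, 0 ≤ t → t ^ 2 ≤ b ^ 2 → t ≤ 1 → 2 / 3 * t ^ 2 ≤ Real.sin b ^ 2 := by
      intro t ht htb ht1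
      have htb' : t ≤ |b| := by rw [← abs_of_nonneg ht]; exact sq_le_sq.mp htb
      have hpi := Real.pi_pos
      have h1 : Real.sin t ≤ Real.sin |b| :=
        Real.sin_le_sin_of_le_of_le_pi_div_two (by linarith) hb.le htb'
      have h2 : 0 ≤ Real.sin t := Real.sin_nonneg_of_nonneg_of_le_pi ht (by linarith)
      rw [hbs]
      refine (two_thirds_mul_sq_le_sin_sq ht ht1).trans ?_
      gcongr
    rcases le_or_gt 0 a with ha0 | ha0
    -- Here `sin² b ≥ (2/3)(1 - 2a)`, while `sinh² (1/2) - sinh² a = sinh (1/2 + a) sinh (1/2 - a)`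
    -- is at most `1.1754 * 0.55 * (1 - 2a)`, and `1.1754 * 0.55 < 2/3`.
    · have hsq : Real.sqrt (1 - 2 * a) ^ 2 = 1 - 2 * a := Real.sq_sqrt (by linarith)
      have h1 := hmono (Real.sqrt (1 - 2 * a)) (Real.sqrt_nonneg _) (by rw [hsq]; linarith)
        (Real.sqrt_le_one.mpr (by linarith))
      rw [hsq] at h1
      have h2 := sinh_sq_sub_sinh_sq (1 / 2) a
      have h3 : Real.sinh (1 / 2 + a) ≤ Real.sinh 1 := Real.sinh_le_sinh.mpr (by linarith)
      have h3' : 0 ≤ Real.sinh (1 / 2 + a) := Real.sinh_nonneg_iff.mpr (by linarith)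
      have h4 : Real.sinh (1 / 2 - a) ≤ 1.1 * (1 / 2 - a) :=
        sinh_le_mul (by linarith) (by linarith)
      have h5 := sinh_one_lt
      nlinarith
    · have h1 := hmono 1 zero_le_one (by linarith) le_rfl
      have h2 := sinh_half_lt
      have h3 : 0 ≤ Real.sinh (1 / 2) := Real.sinh_nonneg_iff.mpr (by norm_num)
      nlinarith [sq_nonneg (Real.sinh a)]

theorem isSharpRadius_Srho : IsSharpRadius FLP Srho (Real.sinh (1 / 2)) := by
  have hR0 : 0 < Real.sinh (1 / 2) := Real.sinh_pos_iff.mpr (by norm_num)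
  have hR1 := sinh_half_lt
  refine isSharpRadius_starClass hR0 (by linarith) (differentiableOn_arsinhC.const_add 1)
    (by simp [arsinhC]) (fun z hz => ?_) fun _ => ?_
  · rw [mem_parabolaRegion]
    simp only [add_re, add_im, one_re, one_im, zero_add]
    -- Outside the region, `|z| = |sinh (arsinhC z)|` would be at least `sinh (1 / 2)`.
    by_contra! h
    have him : |(arsinhC z).im| < Real.pi / 2 := by
      rw [arsinhC, log_im]
      exact abs_arg_lt_pi_div_two_iff.mpr (Or.inl (re_add_sqrt_pos (by linarith)))
    have h1 := sinh_half_sq_le (a := (arsinhC z).re) him (by linarith)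
    rw [← sq_norm_sinh, sinh_arsinhC] at h1
    nlinarith [norm_nonneg z]
  · have h : (1 : ℂ) + (Real.sinh (1 / 2) : ℂ) ^ 2 = (Real.cosh (1 / 2) : ℂ) ^ 2 := by
      have := Real.cosh_sq' (1 / 2)
      exact_mod_cast this.symm
    have h2 : (Real.sinh (1 / 2) : ℂ) + Real.cosh (1 / 2) = ((Real.exp (1 / 2) : ℝ) : ℂ) := by
      rw [← ofReal_add, Real.sinh_add_cosh]
    rw [arsinhC, h, sqrt_ofReal_sq (Real.cosh_pos _).le, h2, ← ofReal_log (Real.exp_pos _).le,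
      Real.log_exp]
    norm_num

/-! ### The function `1 + sin z` -/

/-- From `cosh y ≤ exp (y² / 2) ≤ 1 / (1 - y² / 2)`. The number `0.2757` exceeds `(π / 6)²` and is
just small enough for the constant `0.58`. -/
theorem cosh_sub_one_le {y : ℝ} (hy : y ^ 2 ≤ 0.2757) : Real.cosh y - 1 ≤ 0.58 * y ^ 2 := by
  have h1 := Real.cosh_le_exp_half_sq y
  have h0 := sq_nonneg y
  have h2 := Real.exp_bound_div_one_sub_of_interval (x := y ^ 2 / 2) (by positivity) (by linarith)
  have h3 : 1 / (1 - y ^ 2 / 2) ≤ 1 + 0.58 * y ^ 2 := by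
    rw [div_le_iff₀ (by linarith)]
    nlinarith
  linarith

/-- A linear bound through the point `x = π / 6`, with slope slightly below `cos (π / 6)`. -/
theorem sin_le_of_le_pi_div_six {x : ℝ} (h0 : 0 ≤ x) (h1 : x ≤ Real.pi / 6) :
    Real.sin x ≤ 1 / 2 - 0.85 * (Real.pi / 6 - x) := by
  have hpi := Real.pi_lt_d2
  have hpi0 := Real.pi_pos
  set d := Real.pi / 6 - x with hd
  have h2 := Real.sin_sub_sin (Real.pi / 6) x
  rw [Real.sin_pi_div_six, ← hd] at h2
  have h3 : Real.sin (d / 2) ≥ d / 2 - (d / 2) ^ 3 / 6 := Real.sin_ge_sub_cube (by linarith)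
  have h4 : 0.985 * (d / 2) ≤ d / 2 - (d / 2) ^ 3 / 6 := by
    have : (d / 2) ^ 2 ≤ 0.09 := by nlinarith
    nlinarith
  have h5 : Real.cos (Real.pi / 6) ≤ Real.cos ((Real.pi / 6 + x) / 2) :=
    Real.cos_le_cos_of_nonneg_of_le_pi (by linarith) (by linarith) (by linarith)
  rw [Real.cos_pi_div_six] at h5
  have h6 : (1.73 : ℝ) ≤ Real.sqrt 3 := Real.le_sqrt_of_sq_le (by norm_num)
  have h7 : 0.985 * (d / 2) * 0.865 ≤ Real.sin (d / 2) * Real.cos ((Real.pi / 6 + x) / 2) :=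
    mul_le_mul (by linarith) (by linarith) (by norm_num)
      (le_trans (by nlinarith) (h4.trans h3))
  nlinarith

theorem one_add_sin_mem_parabolaRegion {z : ℂ} (hz : ‖z‖ < Real.pi / 6) :
    1 + sin z ∈ parabolaRegion := by
  have hpi := Real.pi_lt_d2
  have hpi0 := Real.pi_pos
  have hN := sq_norm_eq z
  have hx := abs_le.mp (abs_re_le_norm z)
  have hsum : z.re ^ 2 + z.im ^ 2 < (Real.pi / 6) ^ 2 := by
    rw [← hN]; nlinarith [norm_nonneg z]
  rw [mem_parabolaRegion, sin_eq]
  simp only [← ofReal_sin, ← ofReal_cos, ← ofReal_sinh, ← ofReal_cosh, add_re, add_im, one_re,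
    one_im, mul_re, mul_im, ofReal_re, ofReal_im, I_re, I_im, mul_zero, zero_mul, sub_zero,
    mul_one, add_zero, zero_add]
  set x := z.re
  set y := z.im
  have hy : y ^ 2 ≤ 0.2757 := by nlinarith [sq_nonneg x]
  have hC := cosh_sub_one_le hy
  have hC1 := Real.one_le_cosh y
  have hsc := Real.sin_sq_add_cos_sq x
  have hsh : Real.sinh y ^ 2 ≤ 1.254 * y ^ 2 := by
    rw [Real.sinh_sq]
    nlinarith [sq_nonneg y]
  have hcs : (Real.cos x * Real.sinh y) ^ 2 ≤ (1 - Real.sin x ^ 2) * (1.254 * y ^ 2) := by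
    rw [mul_pow, ← hsc, add_sub_cancel_left]
    gcongr
  -- The goal is `2 sin x cosh y + cos² x sinh² y < 1`. For `x ≥ 0` and `d = π / 6 - x`, the left
  -- side is at most `2 sin x + 1.53 y²`, where `2 sin x ≤ 1 - 1.7 d` and `y² < 1.05 d`; note `1.53
  -- * 1.05 < 1.7`. For `x < 0` the first term is nonpositive and the second is small.
  rcases le_or_gt 0 x with hx0 | hx0
  · have hS := sin_le_of_le_pi_div_six hx0 (by linarith)
    have hS0 : 0 ≤ Real.sin x := Real.sin_nonneg_of_nonneg_of_le_pi hx0 (by linarith)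
    have h1 : Real.sin x * (Real.cosh y - 1) ≤ Real.sin x * (0.58 * y ^ 2) := by gcongr
    have h2 : 1.16 * Real.sin x + 1.254 * (1 - Real.sin x ^ 2) ≤ 1.53 := by
      nlinarith [sq_nonneg (Real.sin x - 0.4625)]
    have h3 : y ^ 2 * (1.16 * Real.sin x + 1.254 * (1 - Real.sin x ^ 2)) ≤ y ^ 2 * 1.53 := by
      gcongr
    have h4 : y ^ 2 < 1.05 * (Real.pi / 6 - x) := by nlinarith
    nlinarith
  · have hS0 : Real.sin x ≤ 0 := Real.sin_nonpos_of_nonpos_of_neg_pi_le hx0.le (by linarith)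
    nlinarith [sq_nonneg y, sq_nonneg (Real.sin x)]

theorem isSharpRadius_Ss : IsSharpRadius FLP Ss (Real.pi / 6) := by
  have hpi := Real.pi_lt_d2
  have hpi0 := Real.pi_pos
  refine isSharpRadius_starClass (by positivity) (by linarith)
    (Differentiable.differentiableOn (by fun_prop)) (by simp)
    (fun z hz => one_add_sin_mem_parabolaRegion hz) fun _ => ?_
  rw [← ofReal_sin, Real.sin_pi_div_six]
  norm_num

end ParabolicRadius

theorem mainTheorem2 :
    ParabolicRadius.IsSharpRadius ParabolicRadius.FLP ParabolicRadius.Sp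
      (Real.tanh (Real.pi / 4) ^ 2) ∧
    ParabolicRadius.IsSharpRadius ParabolicRadius.FLP ParabolicRadius.Ss (Real.pi / 6) ∧
    ParabolicRadius.IsSharpRadius ParabolicRadius.FLP ParabolicRadius.DeltaStar (5 / 12) ∧
    ParabolicRadius.IsSharpRadius ParabolicRadius.FLP ParabolicRadius.Svarrho
      (Real.arcosh (3 / 2) ^ 2) ∧
    ParabolicRadius.IsSharpRadius ParabolicRadius.FLP ParabolicRadius.Srho (Real.sinh (1 / 2)) ∧
    (∃ R : ℝ, R * Real.exp R = 1 / 2 ∧ 0.3517 < R ∧ R < 0.3518 ∧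
      ParabolicRadius.IsSharpRadius ParabolicRadius.FLP ParabolicRadius.Swp R) ∧
    (∀ α : ℝ, 0 ≤ α → α < 1 →
      ParabolicRadius.IsSharpRadius ParabolicRadius.FLP (ParabolicRadius.BS α)
        (if α = 0 then 1 / 2 else (Real.sqrt (1 + α) - 1) / α)) ∧
    (∀ α : ℝ, 0 ≤ α → α < 1 →
      ParabolicRadius.IsSharpRadius ParabolicRadius.FLP (ParabolicRadius.Sexp α)
        (if α < 1 - 1 / (2 * (Real.exp 1 - 1)) then Real.log (1 - 1 / (2 * (α - 1))) else 1)) ∧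
    ParabolicRadius.IsSharpRadius ParabolicRadius.FLP ParabolicRadius.Se (Real.log (3 / 2)) ∧
    (∀ A B : ℝ, -1 < B → B < A → A ≤ 1 →
      (((B ≤ (2 * A - 1) / 3 ∧ A < 0) ∨ (B < (2 * A - 1) / 3 ∧ 0 ≤ A)) →
        ParabolicRadius.IsSharpRadius ParabolicRadius.FLP (ParabolicRadius.Janowski A B)
          (1 / (2 * A - 3 * B))) ∧
      ((((2 * A - 1) / 3 < B ∧ A < 0) ∨ ((2 * A - 1) / 3 ≤ B ∧ 0 ≤ A)) →
        ParabolicRadius.IsSharpRadius ParabolicRadius.FLP (ParabolicRadius.Janowski A B) 1)) := by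
  refine ⟨ParabolicRadius.isSharpRadius_Sp, ParabolicRadius.isSharpRadius_Ss,
    ParabolicRadius.isSharpRadius_DeltaStar, ParabolicRadius.isSharpRadius_Svarrho,
    ParabolicRadius.isSharpRadius_Srho, ParabolicRadius.exists_isSharpRadius_Swp,
    fun α h0 h1 => ParabolicRadius.isSharpRadius_BS h0 h1,
    fun α _ h1 => ParabolicRadius.isSharpRadius_Sexp h1, ParabolicRadius.isSharpRadius_Se,
    fun A B hB hBA hA => ⟨fun h => ?_, fun h => ?_⟩⟩
  -- Both case lists only compare `2A - 3B` with `1`; at equality the two formulas agree.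
  · have h1 : 1 ≤ 2 * A - 3 * B := by rcases h with ⟨h, -⟩ | ⟨h, -⟩ <;> linarith
    have h2 : (2 * A - 3 * B) * (1 / (2 * A - 3 * B)) = 1 :=
      mul_one_div_cancel (by linarith)
    exact ParabolicRadius.isSharpRadius_Janowski hB hBA hA (one_div_pos.mpr (by linarith))
      ((div_le_one (by linarith)).mpr h1) h2.le fun _ => h2
  · have h1 : 2 * A - 3 * B ≤ 1 := by rcases h with ⟨h, -⟩ | ⟨h, -⟩ <;> linarith
    exact ParabolicRadius.isSharpRadius_Janowski hB hBA hA one_pos le_rfl (by linarith)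
      fun h => absurd h (lt_irrefl 1)
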